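/- Let $\mathcal A$ be an abelian length category, that is, an abelian category in which every object $X$ has a finite composition series $0=X_0\subseteq X_1\subseteq\dots\subseteq X_n=X$ with all $X_i/X_{i-1}$ simple (and whose isomorphism classes of objects form a set). Let $\operatorname{ind}\mathcal A$ be the set of isomorphism classes of indecomposable objects of $\mathcal A$, partially ordered by $X\subseteq Y$ if there is a monomorphism $X\to Y$. A length function on $\mathcal A$ is a map $\ell$ assigning to each object $X$ a real number $\ell(X)\ge 0$ such that $\ell(X)=0$ if and only if $X=0$, and $\ell(X)=\ell(X')+\ell(X'')$ for every exact sequence $0\to X'\to X\to X''\to 0$. On the set $\operatorname{Ch}(\mathbb R)$ of finite subsets of $\mathbb R$ consider the total order $$A\le B\quad:\Longleftrightarrow\quad \min(B\setminus A)\le\min(A\setminus B),$$ where $\min\emptyset$ is taken to be larger than every real number. For a length function $\ell$, the Gabriel-Roiter measure $\ell^*\colon\operatorname{ind}\mathcal A\to\operatorname{Ch}(\mathbb R)$ is given by $$\ell^*(X)=\max\bigl\{\{\ell(X_1),\dots,\ell(X_n)\}\;\bigm|\; n\ge 1,\ X_1\subset X_2\subset\dots\subset X_n=X \text{ a finite chain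 in }\operatorname{ind}\mathcal A\bigr\}.$$ (This maximum exists.) Then an indecomposable object $S$ of $\mathcal A$ is simple if and only if there is a length function $\ell$ on $\mathcal A$ such that $\ell^*(S)\le\ell^*(X)$ for all $X\in\operatorname{ind}\mathcal A$. -/

import Mathlib

open CategoryTheory CategoryTheory.Limits

universe v u

namespace GabrielRoiter

noncomputable section

section Chains

set_option linter.unusedSectionVars false

/-! Finite chains of a totally ordered set, with the lexicographic order, and the chain length
function induced by a length function on a poset. -/

/-- The finite chains of a totally ordered set `T`, that is, all its finite subsets. -/
@[ext]
structure Ch (T : Type*) where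
  /-- The underlying finite set of a chain. -/
  toFinset : Finset T

variable {T : Type*} [LinearOrder T]

/-- `X ≤ Y` means `min (Y \ X) ≤ min (X \ Y)`, where the minimum of the empty set is larger than
every element (`Finset.min` takes values in `WithTop T`, and `min ∅ = ⊤`). -/
def Ch.lexLE (X Y : Ch T) : Prop :=
  (Y.toFinset \ X.toFinset).min ≤ (X.toFinset \ Y.toFinset).min

theorem Ch.lexLE_iff (X Y : Ch T) : Ch.lexLE X Y ↔
    ∀ a ∈ X.toFinset, a ∉ Y.toFinset → ∃ b ∈ Y.toFinset, b ∉ X.toFinset ∧ b ≤ a := by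
  unfold Ch.lexLE
  constructor
  · intro h a ha hb
    have h1 : (Y.toFinset \ X.toFinset).min ≤ (a : WithTop T) :=
      h.trans (Finset.min_le (by simp [ha, hb]))
    obtain ⟨b, hb1⟩ := Finset.min_of_nonempty (s := Y.toFinset \ X.toFinset) (by
      by_contra hne
      rw [Finset.not_nonempty_iff_eq_empty] at hne
      simp [hne] at h1)
    have hm := Finset.mem_of_min hb1
    rw [hb1, WithTop.coe_le_coe] at h1
    rw [Finset.mem_sdiff] at hm
    exact ⟨b, hm.1, hm.2, h1⟩
  · intro h
    refine Finset.le_min fun a ha => ?_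
    rw [Finset.mem_sdiff] at ha
    obtain ⟨b, hb, hb', hba⟩ := h a ha.1 ha.2
    exact (Finset.min_le (by simp [hb, hb'])).trans (WithTop.coe_le_coe.2 hba)

/-- Comparison with the colexicographic order of the dual, used to derive the order axioms. -/
def Ch.toColexDual (X : Ch T) : Colex (Finset Tᵒᵈ) :=
  toColex (X.toFinset.map OrderDual.toDual.toEmbedding)

theorem Ch.toColexDual_injective : Function.Injective (Ch.toColexDual (T := T)) := by
  intro X Y h
  exact Ch.ext (Finset.map_injective _ (toColex.injective h))

theorem Ch.lexLE_iff_toColexDual (X Y : Ch T) :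
    Ch.lexLE X Y ↔ X.toColexDual ≤ Y.toColexDual := by
  rw [Ch.lexLE_iff]
  unfold Ch.toColexDual
  rw [Finset.Colex.toColex_le_toColex]
  simp [OrderDual.forall, OrderDual.exists]

/-- The lexicographic order on the finite chains of a totally ordered set. -/
instance : LinearOrder (Ch T) where
  le := Ch.lexLE
  le_refl X := (Ch.lexLE_iff_toColexDual X X).2 le_rfl
  le_trans X Y Z h h' := (Ch.lexLE_iff_toColexDual X Z).2
    (((Ch.lexLE_iff_toColexDual X Y).1 h).trans ((Ch.lexLE_iff_toColexDual Y Z).1 h'))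
  le_antisymm X Y h h' := Ch.toColexDual_injective
    (le_antisymm ((Ch.lexLE_iff_toColexDual X Y).1 h) ((Ch.lexLE_iff_toColexDual Y X).1 h'))
  le_total X Y := by
    simpa only [Ch.lexLE_iff_toColexDual] using le_total X.toColexDual Y.toColexDual
  toDecidableLE := Classical.decRel _

/-- A length function on a poset `S` with values in a poset `T`. -/
structure IsPosetLengthFunction {S T : Type*} [PartialOrder S] [PartialOrder T] (f : S → T) :
    Prop where
  lt_of_lt : ∀ x y, x < y → f x < f y
  total : ∀ x y, f x ≤ f y ∨ f y ≤ f x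
  finite : ∀ x, {t | ∃ x', x' ≤ x ∧ f x' = t}.Finite

variable {S : Type*} [PartialOrder S]

/-- The images `f(X)` of the finite chains `X` of `S` with maximum `x`. -/
def chainImages (f : S → T) (x : S) : Set (Ch T) :=
  {Y | ∃ X : Finset S, IsChain (· ≤ ·) (X : Set S) ∧ IsGreatest (X : Set S) x ∧
    Y.toFinset = X.image f}

theorem chainImages_nonempty (f : S → T) (x : S) : (chainImages f x).Nonempty :=
  ⟨⟨({x} : Finset S).image f⟩, {x}, by simp, by simp, rfl⟩

theorem chainImages_finite {f : S → T} (hf : IsPosetLengthFunction f) (x : S) :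
    (chainImages f x).Finite := by
  refine ((hf.finite x).toFinset.powerset.finite_toSet.preimage
    (f := Ch.toFinset) fun _ _ _ _ h => Ch.ext h).subset ?_
  rintro Y ⟨X, -, hX, hY⟩
  refine Finset.mem_coe.2 (Finset.mem_powerset.2 fun t ht => ?_)
  rw [Set.Finite.mem_toFinset]
  have ht' : t ∈ X.image f := hY ▸ ht
  obtain ⟨x', hx', rfl⟩ := Finset.mem_image.1 ht'
  exact ⟨x', hX.2 hx', rfl⟩

/-- The chain length function `f*(x) = max {f(X) | X a finite chain with maximum x}`. -/
def chainLength (f : S → T) (hf : IsPosetLengthFunction f) (x : S) : Ch T :=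
  (chainImages_finite hf x).toFinset.max'
    ((Set.Finite.toFinset_nonempty _).2 (chainImages_nonempty f x))

theorem chainLength_isGreatest (f : S → T) (hf : IsPosetLengthFunction f) (x : S) :
    IsGreatest (chainImages f x) (chainLength f hf x) := by
  have := Finset.isGreatest_max' (chainImages_finite hf x).toFinset
    ((Set.Finite.toFinset_nonempty _).2 (chainImages_nonempty f x))
  rwa [Set.Finite.coe_toFinset] at this

end Chains

section LengthCategory

variable {C : Type u} [Category.{v} C] [Abelian C]

/-- `X` has a finite composition series `0 = X₀ ⊆ X₁ ⊆ ⋯ ⊆ Xₙ = X`: every `Xᵢ₊₁ / Xᵢ` is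
simple. -/
def HasFiniteLength (X : C) : Prop :=
  ∃ (n : ℕ) (F : Fin (n + 1) →o Subobject X), F 0 = ⊥ ∧ F (Fin.last n) = ⊤ ∧
    ∀ i : Fin n, Simple (cokernel (Subobject.ofLE (F i.castSucc) (F i.succ)
      (F.monotone (Fin.castSucc_lt_succ (i := i)).le)))

variable (C) in
/-- An abelian length category: every object has finite length. -/
class IsLengthCategory : Prop where
  hasFiniteLength : ∀ X : C, HasFiniteLength X

theorem HasFiniteLength.induction {P : C → Prop} (hiso : ∀ X Y : C, (X ≅ Y) → P X → P Y)
    (hzero : ∀ X : C, IsZero X → P X)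
    (hext : ∀ T : ShortComplex C, T.ShortExact → Simple T.X₃ → P T.X₁ → P T.X₂)
    {X : C} (hX : HasFiniteLength X) : P X := by
  obtain ⟨n, F, h0, h1, hs⟩ := hX
  have key : ∀ i : Fin (n + 1), P (F i : C) := by
    intro i
    induction i using Fin.induction with
    | zero =>
      rw [h0]
      exact hzero _ ((isZero_zero C).of_iso Subobject.botCoeIsoZero)
    | succ i ih =>
      let f := Subobject.ofLE (F i.castSucc) (F i.succ)
        (F.monotone (Fin.castSucc_lt_succ (i := i)).le)
      exact hext (ShortComplex.mk f (cokernel.π f) (cokernel.condition f))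
        { exact := ShortComplex.exact_cokernel f
          mono_f := inferInstanceAs (Mono f)
          epi_g := inferInstanceAs (Epi (cokernel.π f)) } (hs i) ih
  have := key (Fin.last n)
  rw [h1] at this
  exact hiso _ _ (asIso (⊤ : Subobject X).arrow) this

/-- Intersecting a subobject `Y` of the middle term of a short exact sequence with the left term. -/
theorem exists_restrict (T : ShortComplex C) (hT : T.ShortExact) (hS : Simple T.X₃) {Y : C}
    (i : Y ⟶ T.X₂) [Mono i] :
    (∃ j : Y ⟶ T.X₁, Mono j) ∨
    ∃ (U : ShortComplex C) (φ : U ⟶ T), U.ShortExact ∧ U.X₂ = Y ∧ Mono φ.τ₁ ∧ Mono φ.τ₂ ∧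
      IsIso φ.τ₃ ∧ (IsIso φ.τ₂ → IsIso i) := by
  have := hT.mono_f
  by_cases h : i ≫ T.g = 0
  · left
    refine ⟨hT.exact.lift i h, ?_⟩
    have : Mono (hT.exact.lift i h ≫ T.f) := by rw [hT.exact.lift_f]; infer_instance
    exact mono_of_mono _ T.f
  · right
    have he : Epi (i ≫ T.g) := epi_of_nonzero_to_simple h
    let U : ShortComplex C := ShortComplex.mk (kernel.ι (i ≫ T.g)) (i ≫ T.g) (kernel.condition _)
    have hk : (kernel.ι (i ≫ T.g) ≫ i) ≫ T.g = 0 := by simp [kernel.condition]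
    let φ : U ⟶ T :=
      { τ₁ := hT.exact.lift (kernel.ι (i ≫ T.g) ≫ i) hk
        τ₂ := i
        τ₃ := 𝟙 _
        comm₁₂ := by simp [U]
        comm₂₃ := by simp [U] }
    refine ⟨U, φ, ?_, rfl, ?_, inferInstanceAs (Mono i), inferInstanceAs (IsIso (𝟙 T.X₃)), id⟩
    · exact
        { exact := ShortComplex.exact_kernel _
          mono_f := inferInstanceAs (Mono (kernel.ι (i ≫ T.g)))
          epi_g := he }
    · have : Mono (φ.τ₁ ≫ T.f) := by
        rw [hT.exact.lift_f]; infer_instance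
      exact mono_of_mono _ T.f

/-- An auxiliary bound: after `n` passages to a proper subobject, starting from `X`, only the zero
object is left. It serves to show that `⊆` is antisymmetric on isomorphism classes. -/
def LengthLE : ℕ → C → Prop
  | 0, X => IsZero X
  | n + 1, X => ∀ (Y : C) (f : Y ⟶ X), Mono f → ¬ IsIso f → LengthLE n Y

theorem LengthLE.of_mono : ∀ {n : ℕ} {X Y : C} (f : Y ⟶ X) [Mono f], LengthLE n X → LengthLE n Y
  | 0, _, _, f, _, h => IsZero.of_mono f h
  | _ + 1, _, Y, f, hf, h => by
    intro Z g hg hni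
    refine h Z (g ≫ f) inferInstance fun hi => hni ?_
    have : Epi f := epi_of_epi g f
    have : IsIso f := isIso_of_mono_of_epi f
    exact IsIso.of_isIso_comp_right g f

theorem LengthLE.ext : ∀ {n : ℕ} (T : ShortComplex C), T.ShortExact → Simple T.X₃ →
    LengthLE n T.X₁ → LengthLE (n + 1) T.X₂
  | n, T, hT, _, h => by
    intro Y i hi hni
    rcases exists_restrict T hT ‹_› i with ⟨j, hj⟩ | ⟨U, φ, hU, rfl, h1, h2, h3, hiso⟩
    · exact LengthLE.of_mono j h
    · have hn : ¬ IsIso φ.τ₁ := fun h1' =>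
        hni (hiso (ShortComplex.isIso₂_of_shortExact_of_isIso₁₃ φ hU hT))
      cases n with
      | zero =>
        exact (hn (isIso_of_source_target_iso_zero φ.τ₁
          (IsZero.of_mono φ.τ₁ h).isoZero (IsZero.isoZero h))).elim
      | succ n =>
        exact LengthLE.ext U hU (Simple.of_iso (asIso φ.τ₃)) (h _ φ.τ₁ h1 hn)

theorem HasFiniteLength.exists_lengthLE {X : C} (hX : HasFiniteLength X) :
    ∃ n, LengthLE n X := by
  refine HasFiniteLength.induction (P := fun X => ∃ n, LengthLE n X) ?_ ?_ ?_ hX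
  · rintro X Y e ⟨n, h⟩
    exact ⟨n, h.of_mono e.inv⟩
  · exact fun X h => ⟨0, h⟩
  · rintro T hT hS ⟨n, h⟩
    exact ⟨n + 1, LengthLE.ext T hT hS h⟩

theorem isIso_of_mono_endo [IsLengthCategory C] {X : C} (f : X ⟶ X) [hf : Mono f] : IsIso f := by
  obtain ⟨n, hn⟩ := (IsLengthCategory.hasFiniteLength X).exists_lengthLE
  by_contra hni
  induction n with
  | zero => exact hni (isIso_of_source_target_iso_zero f (IsZero.isoZero hn) (IsZero.isoZero hn))
  | succ n ih => exact ih (hn X f hf hni)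

theorem isIso_of_mono_of_mono [IsLengthCategory C] {X Y : C} (f : X ⟶ Y) (g : Y ⟶ X)
    [Mono f] [Mono g] : IsIso f := by
  have : IsIso (g ≫ f) := isIso_of_mono_endo _
  have : Epi f := epi_of_epi g f
  exact isIso_of_mono_of_epi f

/-- A length function on an abelian category. -/
structure LengthFunction (C : Type u) [Category.{v} C] [Abelian C] where
  toFun : C → ℝ
  nonneg : ∀ X, 0 ≤ toFun X
  eq_zero_iff : ∀ X, toFun X = 0 ↔ IsZero X
  additive : ∀ T : ShortComplex C, T.ShortExact → toFun T.X₂ = toFun T.X₁ + toFun T.X₃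

theorem LengthFunction.eq_add_cokernel (l : LengthFunction C) {X Y : C} (f : X ⟶ Y) [Mono f] :
    l.toFun Y = l.toFun X + l.toFun (cokernel f) :=
  l.additive (ShortComplex.mk f (cokernel.π f) (cokernel.condition f))
    { exact := ShortComplex.exact_cokernel f
      mono_f := inferInstanceAs (Mono f)
      epi_g := inferInstanceAs (Epi (cokernel.π f)) }

theorem LengthFunction.eq_of_isIso (l : LengthFunction C) {X Y : C} (f : X ⟶ Y) [IsIso f] :
    l.toFun X = l.toFun Y := by
  have h : l.toFun (cokernel f) = 0 :=
    (l.eq_zero_iff _).2 ((isZero_zero C).of_iso (cokernel.ofEpi f))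
  rw [l.eq_add_cokernel f, h, add_zero]

theorem LengthFunction.lt_of_mono (l : LengthFunction C) {X Y : C} (f : X ⟶ Y) [Mono f]
    (hf : ¬ IsIso f) : l.toFun X < l.toFun Y := by
  rw [l.eq_add_cokernel f]
  refine lt_add_of_pos_right _ (lt_of_le_of_ne (l.nonneg _) fun h => hf ?_)
  have hz := (l.eq_zero_iff _).1 h.symm
  have : Epi f := Preadditive.epi_of_cokernel_zero (hz.eq_of_tgt _ _)
  exact isIso_of_mono_of_epi f

theorem LengthFunction.finite_values (l : LengthFunction C) {X : C} (hX : HasFiniteLength X) :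
    {t : ℝ | ∃ (Y : C) (f : Y ⟶ X), Mono f ∧ l.toFun Y = t}.Finite := by
  refine HasFiniteLength.induction
    (P := fun X => {t : ℝ | ∃ (Y : C) (f : Y ⟶ X), Mono f ∧ l.toFun Y = t}.Finite) ?_ ?_ ?_ hX
  · rintro X Y e h
    refine h.subset ?_
    rintro t ⟨Z, f, hf, rfl⟩
    exact ⟨Z, f ≫ e.inv, inferInstance, rfl⟩
  · intro X h
    refine (Set.finite_singleton (0 : ℝ)).subset ?_
    rintro t ⟨Y, f, hf, rfl⟩
    exact (l.eq_zero_iff Y).2 (IsZero.of_mono f h)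
  · intro T hT hS h
    refine (h.union (h.image (fun t => t + l.toFun T.X₃))).subset ?_
    rintro t ⟨Y, f, hf, rfl⟩
    rcases exists_restrict T hT hS f with ⟨j, hj⟩ | ⟨U, φ, hU, rfl, h1, h2, h3, -⟩
    · exact Or.inl ⟨Y, j, hj, rfl⟩
    · refine Or.inr ⟨l.toFun U.X₁, ⟨U.X₁, φ.τ₁, h1, rfl⟩, ?_⟩
      rw [l.additive U hU, l.eq_of_isIso φ.τ₃]

variable (C) in
/-- Isomorphism of indecomposable objects. -/
def indSetoid : Setoid {X : C // Indecomposable X} where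
  r X Y := Nonempty (X.1 ≅ Y.1)
  iseqv :=
    { refl := fun _ => ⟨Iso.refl _⟩
      symm := fun ⟨e⟩ => ⟨e.symm⟩
      trans := fun ⟨e⟩ ⟨e'⟩ => ⟨e.trans e'⟩ }

variable (C) in
/-- The isomorphism classes of indecomposable objects. -/
def Ind : Type _ := Quotient (indSetoid C)

/-- The isomorphism class of an indecomposable object. -/
def Ind.mk (X : C) (hX : Indecomposable X) : Ind C := Quotient.mk (indSetoid C) ⟨X, hX⟩

/-- The subobject relation: `X ⊆ Y` if there is a monomorphism from `X` to `Y`. -/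
instance : LE (Ind C) where
  le := Quotient.lift₂ (fun X Y => ∃ f : X.1 ⟶ Y.1, Mono f) (by
    rintro X Y X' Y' ⟨e⟩ ⟨e'⟩
    refine propext ⟨?_, ?_⟩
    · rintro ⟨f, hf⟩
      exact ⟨e.inv ≫ f ≫ e'.hom, inferInstance⟩
    · rintro ⟨f, hf⟩
      exact ⟨e.hom ≫ f ≫ e'.inv, inferInstance⟩)

theorem Ind.mk_le_mk {X Y : C} (hX : Indecomposable X) (hY : Indecomposable Y) :
    Ind.mk X hX ≤ Ind.mk Y hY ↔ ∃ f : X ⟶ Y, Mono f := Iff.rfl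

instance [IsLengthCategory C] : PartialOrder (Ind C) where
  le_refl X := by
    induction X using Quotient.inductionOn with
    | _ X => exact ⟨𝟙 _, inferInstance⟩
  le_trans X Y Z := by
    induction X using Quotient.inductionOn with
    | _ X =>
    induction Y using Quotient.inductionOn with
    | _ Y =>
    induction Z using Quotient.inductionOn with
    | _ Z =>
    rintro ⟨f, hf⟩ ⟨g, hg⟩
    exact ⟨f ≫ g, inferInstance⟩
  le_antisymm X Y := by
    induction X using Quotient.inductionOn with
    | _ X =>
    induction Y using Quotient.inductionOn with
    | _ Y =>
    rintro ⟨f, hf⟩ ⟨g, hg⟩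
    have := isIso_of_mono_of_mono f g
    exact Quotient.sound ⟨asIso f⟩

/-- The map on isomorphism classes of indecomposable objects induced by a length function. -/
def LengthFunction.onInd (l : LengthFunction C) : Ind C → ℝ :=
  Quotient.lift (fun X => l.toFun X.1) (fun _ _ ⟨e⟩ => l.eq_of_isIso e.hom)

theorem LengthFunction.onInd_mk (l : LengthFunction C) {X : C} (hX : Indecomposable X) :
    l.onInd (Ind.mk X hX) = l.toFun X := rfl

theorem LengthFunction.isPosetLengthFunction_onInd [IsLengthCategory C] (l : LengthFunction C) :
    IsPosetLengthFunction l.onInd where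
  lt_of_lt X Y := by
    induction X using Quotient.inductionOn with
    | _ X =>
    induction Y using Quotient.inductionOn with
    | _ Y =>
    rintro h
    obtain ⟨f, hf⟩ := h.le
    exact l.lt_of_mono f fun hi => h.ne (Quotient.sound ⟨asIso f⟩)
  total X Y := le_total _ _
  finite X := by
    induction X using Quotient.inductionOn with
    | _ X =>
    refine (l.finite_values (IsLengthCategory.hasFiniteLength X.1)).subset ?_
    rintro t ⟨Y, hY, rfl⟩
    induction Y using Quotient.inductionOn with
    | _ Y =>
    obtain ⟨f, hf⟩ := hY
    exact ⟨Y.1, f, hf, rfl⟩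

/-- The Gabriel-Roiter measure with respect to a length function: the chain length function of
its restriction to the poset of isomorphism classes of indecomposable objects. -/
def LengthFunction.gabrielRoiterMeasure [IsLengthCategory C] (l : LengthFunction C) :
    Ind C → Ch ℝ :=
  chainLength l.onInd l.isPosetLengthFunction_onInd

end LengthCategory

end

end GabrielRoiter

namespace GabrielRoiter

/-! ### Composition length and its additivity. -/

section CompositionLength

open scoped ZeroObject

variable {C : Type u} [Category.{v} C] [Abelian C]

/-! Every nonzero object contains a simple object, and a simple `Y` has measure `{ℓ(Y)}`. If a
simple `Y` embeds in an indecomposable `X`, the chain `Y ⊆ X` shows `{ℓ(Y), ℓ(X)} ≤ ℓ*(X)`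
(`LengthFunction.pair_le_gabrielRoiterMeasure`). The order on finite sets extends inclusion.

If `S` is simple, let `ℓ` be composition length. All simple objects have length `1`, so `ℓ*(S) = {1}
⊆ {1, ℓ(X)}`, whence `ℓ*(S) ≤ ℓ*(X)`.

Conversely, if `ℓ*(S)` is minimal and `Y` is a simple subobject of `S`, then `{ℓ(Y), ℓ(S)} ≤ ℓ*(S) ≤
ℓ*(Y) = {ℓ(Y)}`. No finite set is `≤` a proper subset of itself, so `ℓ(S) = ℓ(Y)` and `Y ⟶ S` is an
isomorphism.

Most of the work is to show that composition length is a length function, that is,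
`compositionLength_additive`. -/

theorem LengthLE.succ {n : ℕ} {X : C} (h : LengthLE n X) : LengthLE (n + 1) X :=
  fun _ f _ _ => h.of_mono f

theorem LengthLE.mono {m n : ℕ} (hmn : m ≤ n) {X : C} (h : LengthLE m X) : LengthLE n X := by
  induction hmn with
  | refl => exact h
  | step _ ih => exact ih.succ

/-- Every nonzero object of bounded length has a simple subobject. -/
theorem LengthLE.exists_simple_mono :
    ∀ {n : ℕ} {X : C}, LengthLE n X → ¬ IsZero X → ∃ (Y : C) (f : Y ⟶ X), Simple Y ∧ Mono f
  | 0, _, h, hX => (hX h).elim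
  | n + 1, X, h, hX => by
    by_cases hs : Simple X
    · exact ⟨X, 𝟙 X, hs, inferInstance⟩
    · obtain ⟨Y, f, hf, hni, hf0⟩ :
          ∃ (Y : C) (f : Y ⟶ X), Mono f ∧ ¬ IsIso f ∧ f ≠ 0 := by
        by_contra! hc
        refine hs ⟨fun {Y} f _ => ⟨fun _ h0 => ?_, fun h0 => ?_⟩⟩
        · subst h0
          exact hX (IsZero.of_epi_eq_zero (0 : Y ⟶ X) rfl)
        · by_contra hni
          exact h0 (hc Y f inferInstance hni)
      obtain ⟨Z, g, hZ, hg⟩ :=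
        (h Y f hf hni).exists_simple_mono fun hY => hf0 (hY.eq_of_src _ _)
      exact ⟨Z, g ≫ f, hZ, inferInstance⟩

variable [IsLengthCategory C]

theorem exists_lengthLE (X : C) : ∃ n, LengthLE n X :=
  (IsLengthCategory.hasFiniteLength X).exists_lengthLE

open Classical in
/-- The composition length of an object, as the maximal length of a chain of proper
subobjects. -/
noncomputable def compositionLength (X : C) : ℕ := Nat.find (exists_lengthLE X)

theorem lengthLE_iff {X : C} {n : ℕ} : LengthLE n X ↔ compositionLength X ≤ n := by
  classical
  exact ⟨fun h => Nat.find_min' _ h, fun h => (Nat.find_spec (exists_lengthLE X)).mono h⟩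

theorem compositionLength_eq_zero_iff {X : C} : compositionLength X = 0 ↔ IsZero X := by
  rw [← Nat.le_zero, ← lengthLE_iff]
  rfl

theorem compositionLength_le_of_mono {X Y : C} (f : Y ⟶ X) [Mono f] :
    compositionLength Y ≤ compositionLength X :=
  lengthLE_iff.1 ((lengthLE_iff.2 le_rfl).of_mono f)

theorem compositionLength_eq_of_iso {X Y : C} (e : X ≅ Y) :
    compositionLength X = compositionLength Y :=
  (compositionLength_le_of_mono e.hom).antisymm (compositionLength_le_of_mono e.inv)

theorem compositionLength_lt_of_mono {X Y : C} (f : Y ⟶ X) [hf : Mono f] (hni : ¬ IsIso f) :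
    compositionLength Y < compositionLength X := by
  have h : LengthLE (compositionLength X) X := lengthLE_iff.2 le_rfl
  cases hn : compositionLength X with
  | zero =>
    rw [compositionLength_eq_zero_iff] at hn
    exact (hni (isIso_of_source_target_iso_zero f (IsZero.of_mono f hn).isoZero hn.isoZero)).elim
  | succ n =>
    rw [hn] at h
    exact Nat.lt_succ_of_le (lengthLE_iff.1 (h Y f hf hni))

/-- The upper bound is `LengthLE.ext`; the lower bound holds because `T.f` is a proper inclusion,
its cokernel being simple and hence nonzero. -/
theorem compositionLength_of_simple_quotient (T : ShortComplex C) (hT : T.ShortExact)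
    (hS : Simple T.X₃) : compositionLength T.X₂ = compositionLength T.X₁ + 1 := by
  refine le_antisymm (lengthLE_iff.1 (LengthLE.ext T hT hS (lengthLE_iff.2 le_rfl))) ?_
  have := hT.mono_f
  have := hT.epi_g
  refine compositionLength_lt_of_mono T.f fun _ => Simple.not_isZero T.X₃ ?_
  exact IsZero.of_epi_eq_zero T.g (by rw [← cancel_epi T.f, T.zero, comp_zero])

theorem compositionLength_of_isZero_quotient (T : ShortComplex C) (hT : T.ShortExact)
    (h : IsZero T.X₃) : compositionLength T.X₂ = compositionLength T.X₁ := by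
  have := hT.isIso_f_iff.2 h
  exact (compositionLength_eq_of_iso (asIso T.f)).symm

/-- Induction along a composition series of the quotient, each step splitting off one simple factor
by passing to a preimage in the middle term. -/
theorem compositionLength_additive (T : ShortComplex C) (hT : T.ShortExact) :
    compositionLength T.X₂ = compositionLength T.X₁ + compositionLength T.X₃ := by
  -- The quotient becomes a variable `Z`, with the rest of the sequence universally quantified in
  -- the induction hypothesis.
  suffices H : ∀ Z : C, ∀ (X Y : C) (f : X ⟶ Y) (g : Y ⟶ Z) (w : f ≫ g = 0),
      (ShortComplex.mk f g w).ShortExact →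
        compositionLength Y = compositionLength X + compositionLength Z from
    H T.X₃ T.X₁ T.X₂ T.f T.g T.zero hT
  intro Z
  refine HasFiniteLength.induction (P := fun Z => ∀ (X Y : C) (f : X ⟶ Y) (g : Y ⟶ Z)
    (w : f ≫ g = 0), (ShortComplex.mk f g w).ShortExact →
        compositionLength Y = compositionLength X + compositionLength Z) ?_ ?_ ?_
        (IsLengthCategory.hasFiniteLength Z)
  · intro Z Z' e h X Y f g w hE
    rw [← compositionLength_eq_of_iso e]
    refine h X Y f (g ≫ e.inv) (by rw [← Category.assoc, w, zero_comp]) ?_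
    refine ShortComplex.shortExact_of_iso ?_ hE
    exact ShortComplex.isoMk (Iso.refl _) (Iso.refl _) e.symm (by simp) (by simp)
  · intro Z hZ X Y f g w hE
    rw [compositionLength_eq_zero_iff.2 hZ, add_zero]
    exact compositionLength_of_isZero_quotient _ hE hZ
  · intro U hU hS ih X Y f g w hE
    have hf : Mono f := hE.mono_f
    have hg : Epi g := hE.epi_g
    have := hU.mono_f
    have := hU.epi_g
    -- The pullback `P` is the preimage of `U.X₁` in `Y`: `hK` says `Y / P ≅ U.X₃`, which is simple,
    -- and `hL` says `P / X ≅ U.X₁`, to which `ih` applies.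
    let k : pullback U.f g ⟶ Y := pullback.snd U.f g
    have hk : k ≫ g ≫ U.g = 0 := by
      rw [← Category.assoc, ← pullback.condition, Category.assoc, U.zero, comp_zero]
    have hK : (ShortComplex.mk k (g ≫ U.g) hk).ShortExact :=
      { exact := by
          refine ShortComplex.exact_of_f_is_kernel _ ?_
          refine KernelFork.IsLimit.ofι' _ _ fun {A} a ha => ?_
          refine ⟨pullback.lift (hU.exact.lift (a ≫ g) (by simpa using ha)) a
            (hU.exact.lift_f _ _), pullback.lift_snd _ _ _⟩
        mono_f := inferInstanceAs (Mono (pullback.snd U.f g))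
        epi_g := inferInstanceAs (Epi (g ≫ U.g)) }
    let i : X ⟶ pullback U.f g := pullback.lift 0 f (by simp [w])
    have hi : i ≫ k = f := pullback.lift_snd _ _ _
    have hi0 : i ≫ pullback.fst U.f g = 0 := pullback.lift_fst _ _ _
    have : Mono (i ≫ k) := by rw [hi]; exact hf
    have hmi : Mono i := mono_of_mono i k
    have hL : (ShortComplex.mk i (pullback.fst U.f g) hi0).ShortExact :=
      { exact := by
          refine ShortComplex.exact_of_f_is_kernel _ ?_
          refine KernelFork.IsLimit.ofι' _ _ fun {A} a ha => ?_
          have ha' : (a ≫ k) ≫ g = 0 := by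
            rw [Category.assoc, ← pullback.condition, ← Category.assoc, ha, zero_comp]
          refine ⟨hE.exact.lift (a ≫ k) ha', ?_⟩
          have hl : hE.exact.lift (a ≫ k) ha' ≫ f = a ≫ k := hE.exact.lift_f _ _
          exact (cancel_mono k).1 (by rw [Category.assoc, hi, hl])
        mono_f := hmi
        epi_g := inferInstanceAs (Epi (pullback.fst U.f g)) }
    have h1 := compositionLength_of_simple_quotient _ hK hS
    have h2 := ih _ _ _ _ _ hL
    have h3 := compositionLength_of_simple_quotient _ hU hS
    dsimp only at h1
    omega

theorem compositionLength_of_simple (X : C) [Simple X] : compositionLength X = 1 := by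
  have := compositionLength_of_simple_quotient (ShortComplex.mk (0 : (0 : C) ⟶ X) (𝟙 X) zero_comp)
    { exact := (ShortComplex.exact_iff_mono _ rfl).2 (inferInstanceAs (Mono (𝟙 X)))
      mono_f := ⟨fun _ _ _ => (isZero_zero C).eq_of_tgt _ _⟩
      epi_g := inferInstanceAs (Epi (𝟙 X)) } ‹_›
  rwa [compositionLength_eq_zero_iff.2 (isZero_zero C)] at this

variable (C) in
/-- The composition length as a length function. -/
noncomputable def LengthFunction.composition : LengthFunction C where
  toFun X := compositionLength X
  nonneg _ := Nat.cast_nonneg _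
  eq_zero_iff _ := Nat.cast_eq_zero.trans compositionLength_eq_zero_iff
  additive T hT := by rw [compositionLength_additive T hT, Nat.cast_add]

end CompositionLength

/-! ### Measures of simple objects and a lower bound from subobjects. -/

section Measure

variable {C : Type u} [Category.{v} C] [Abelian C]

theorem Ind.eq_mk_of_le_of_simple {Y : C} [Simple Y] (hY : Indecomposable Y) {X : Ind C}
    (h : X ≤ Ind.mk Y hY) : X = Ind.mk Y hY := by
  induction X using Quotient.inductionOn with
  | _ X =>
  obtain ⟨f, hf⟩ := h
  have := isIso_of_mono_of_nonzero (f := f) fun h0 => X.2.1 (IsZero.of_mono_eq_zero f h0)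
  exact Quotient.sound ⟨asIso f⟩

variable [IsLengthCategory C]

theorem exists_simple_mono {X : C} (hX : ¬ IsZero X) :
    ∃ (Y : C) (f : Y ⟶ X), Simple Y ∧ Mono f :=
  (exists_lengthLE X).choose_spec.exists_simple_mono hX

/-- In this form the condition is vacuous when `A ⊆ B`, and it fails when `B` is a proper subset of
`A`. -/
theorem Ch.le_iff {T : Type*} [LinearOrder T] (A B : Ch T) : A ≤ B ↔
    ∀ a ∈ A.toFinset, a ∉ B.toFinset → ∃ b ∈ B.toFinset, b ∉ A.toFinset ∧ b ≤ a :=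
  Ch.lexLE_iff A B

/-- The Gabriel-Roiter measure of a simple object `Y` is `{ℓ(Y)}`. -/
theorem LengthFunction.gabrielRoiterMeasure_of_simple (l : LengthFunction C) {Y : C} [Simple Y]
    (hY : Indecomposable Y) : l.gabrielRoiterMeasure (Ind.mk Y hY) = ⟨{l.toFun Y}⟩ := by
  obtain ⟨A, -, hA, hm⟩ :=
    (chainLength_isGreatest l.onInd l.isPosetLengthFunction_onInd (Ind.mk Y hY)).1
  have hA' : A = {Ind.mk Y hY} :=
    Finset.eq_singleton_iff_unique_mem.2
      ⟨hA.1, fun X hX => Ind.eq_mk_of_le_of_simple hY (hA.2 hX)⟩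
  refine Ch.ext (hm.trans ?_)
  rw [hA', Finset.image_singleton, l.onInd_mk]

/-- The measure is a maximum over chains and `Y ⊆ X` is one of them. If `f` is an isomorphism the
chain collapses to one element, which does no harm. -/
theorem LengthFunction.pair_le_gabrielRoiterMeasure (l : LengthFunction C) {X Y : C}
    (hX : Indecomposable X) (hY : Indecomposable Y) (f : Y ⟶ X) [hf : Mono f] :
    (⟨{l.toFun Y, l.toFun X}⟩ : Ch ℝ) ≤ l.gabrielRoiterMeasure (Ind.mk X hX) := by
  classical
  have hle : Ind.mk Y hY ≤ Ind.mk X hX := ⟨f, hf⟩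
  refine (chainLength_isGreatest l.onInd l.isPosetLengthFunction_onInd (Ind.mk X hX)).2
    ⟨{Ind.mk Y hY, Ind.mk X hX}, ?_, ⟨by simp, ?_⟩, ?_⟩
  · rw [Finset.coe_pair]
    exact IsChain.pair hle
  · intro Z hZ
    rw [Finset.coe_pair] at hZ
    rcases hZ with rfl | rfl
    exacts [hle, le_rfl]
  · rw [Finset.image_insert, Finset.image_singleton, l.onInd_mk, l.onInd_mk]

end Measure

end GabrielRoiter

/-! ### The characterization of simple objects. -/

theorem mainTheorem5 {C : Type u} [Category.{v} C] [Abelian C] [GabrielRoiter.IsLengthCategory C]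
    (S : C) (hS : Indecomposable S) :
    Simple S ↔ ∃ l : GabrielRoiter.LengthFunction C, ∀ X : GabrielRoiter.Ind C,
      l.gabrielRoiterMeasure (GabrielRoiter.Ind.mk S hS) ≤ l.gabrielRoiterMeasure X := by
  constructor
  · intro hs
    refine ⟨GabrielRoiter.LengthFunction.composition C, fun X => ?_⟩
    induction X using Quotient.inductionOn with
    | _ X =>
    obtain ⟨Y, f, hY, hf⟩ := GabrielRoiter.exists_simple_mono X.2.1
    rw [GabrielRoiter.LengthFunction.gabrielRoiterMeasure_of_simple]
    refine le_trans ?_ (GabrielRoiter.LengthFunction.pair_le_gabrielRoiterMeasure _ X.2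
      (indecomposable_of_simple Y) f)
    have hSY : GabrielRoiter.compositionLength S = GabrielRoiter.compositionLength Y := by
      rw [GabrielRoiter.compositionLength_of_simple, GabrielRoiter.compositionLength_of_simple]
    -- Inclusion suffices: the only element `ℓ(S)` of the left side equals `ℓ(Y)`.
    refine (GabrielRoiter.Ch.le_iff _ _).2 fun a ha hb => (hb ?_).elim
    rw [Finset.mem_singleton.1 ha]
    exact Finset.mem_insert.2 (Or.inl (congrArg Nat.cast hSY))
  · rintro ⟨l, hl⟩
    obtain ⟨Y, f, hY, hf⟩ := GabrielRoiter.exists_simple_mono hS.1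
    have hYi := indecomposable_of_simple Y
    have h := (l.pair_le_gabrielRoiterMeasure hS hYi f).trans (hl (GabrielRoiter.Ind.mk Y hYi))
    rw [l.gabrielRoiterMeasure_of_simple hYi, GabrielRoiter.Ch.le_iff] at h
    have hSY : l.toFun S = l.toFun Y := by
      by_contra hne
      -- Otherwise `ℓ(S)` lies outside `{ℓ(Y)}`, and the order demands an element of `{ℓ(Y)}`
      -- outside `{ℓ(Y), ℓ(S)}`.
      obtain ⟨b, hb, hb', -⟩ := h (l.toFun S) (by simp) (by simpa using hne)
      exact hb' (by rw [Finset.mem_singleton.1 hb]; simp)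
    have : IsIso f := by
      by_contra hni
      exact (l.lt_of_mono f hni).ne hSY.symm
    exact Simple.of_iso (asIso f).symm
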